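/- Let $n\ge 0$ and let $U\subseteq[n]\times[n]$ be a set of positions ("unspecified entries") of an $n\times n$ matrix; put $U^c=([n]\times[n])\setminus U$. A completion of a partial filling $A\in\mathbb R^{U^c}$ is a real $n\times n$ matrix whose entries at the positions in $U^c$ are those of $A$. An integer $r$ is a typical rank of $U^c$ if there is a Zariski dense subset of $\mathbb R^{U^c}$ such that for each $A$ in it the lowest rank of a completion of $A$ is $r$; the typical coranks of $U^c$ are the numbers $n-r$ with $r$ a typical rank. For $m\ge 1$ let $G(m,1)=\{(i,i): 1\le i\le m\}$; we write $U=G(m,1)$ if $U$ agrees with this set up to permutations of the rows and of the columns of the $n\times n$ matrix (so $n \geq m$, and $U$ consists of $m$ entries in pairwise distinct rows and pairwise distinct columns). Theorem. $1$ is a typical corank of $U^c$ if and only if one of the following holds: 1. $U$ is nonempty and all entries of $U$ lie in the union of a single row and a single column; 2. $U=G(3,1)$; 3. $U=G(4,1)$. Moreover, if $U$ is nonempty and none of 1, 2, 3 holds, then $n \geq 2$ and a generic real partial filling can be completed over the reals to corank $2$ in the following sense: there is a proper Zariski closed subset of $\mathbb R^{U^c}$ such that every $A\in\mathbb R^{U^c}$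 outside it has a real completion of rank at most $n-2$. -/

import Mathlib

namespace MatrixCompletion

/-- A partial filling of an `n × m` matrix with specified positions `S`: a point of `ℝ^S`. -/
abbrev PartialFilling {n m : ℕ} (S : Finset (Fin n × Fin m)) : Type := S → ℝ

/-- The matrix `M` is a real completion of the partial filling `A`. -/
def IsCompletion {n m : ℕ} {S : Finset (Fin n × Fin m)} (A : PartialFilling S)
    (M : Matrix (Fin n) (Fin m) ℝ) : Prop :=
  ∀ p : S, M p.1.1 p.1.2 = A p

/-- `r` is the lowest rank to which `A` can be completed over `ℝ`. -/
def IsCompletionRank {n m : ℕ} {S : Finset (Fin n × Fin m)} (A : PartialFilling S)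
    (r : ℕ) : Prop :=
  IsLeast {k : ℕ | ∃ M : Matrix (Fin n) (Fin m) ℝ, IsCompletion A M ∧ M.rank = k} r

/-- A subset of `ℝ^σ` is Zariski dense if no nonzero polynomial vanishes on it. -/
def IsZariskiDense {σ : Type} (D : Set (σ → ℝ)) : Prop :=
  ∀ f : MvPolynomial σ ℝ, (∀ x ∈ D, MvPolynomial.eval x f = 0) → f = 0

/-- `r` is a typical rank of `S`: on a Zariski dense set of real partial fillings of `S`, the
lowest rank to which the filling can be completed over `ℝ` is `r`. -/
def IsTypicalRank {n m : ℕ} (S : Finset (Fin n × Fin m)) (r : ℕ) : Prop :=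
  ∃ D : Set (PartialFilling S), IsZariskiDense D ∧ ∀ A ∈ D, IsCompletionRank A r

/-- The typical coranks of `S` are `min n m` minus the typical ranks. -/
def IsTypicalCorank {n m : ℕ} (S : Finset (Fin n × Fin m)) (c : ℕ) : Prop :=
  ∃ r : ℕ, IsTypicalRank S r ∧ r + c = min n m

/-- `S` is generically completable to rank `r` over `ℝ`: every real partial filling outside a
proper Zariski closed subset of `ℝ^S` has a completion in the variety of matrices of
rank at most `r`. -/
def IsGenericallyRealCompletable {n m : ℕ} (S : Finset (Fin n × Fin m)) (r : ℕ) : Prop :=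
  ∃ f : MvPolynomial S ℝ, f ≠ 0 ∧ ∀ A : PartialFilling S, MvPolynomial.eval A f ≠ 0 →
    ∃ M : Matrix (Fin n) (Fin m) ℝ, IsCompletion A M ∧ M.rank ≤ r

/-- The bipartite circulant graph `G(m, k)` on `[m] ⊔ [m]`, as a set of matrix entries: the edges
are `(i, i), (i, i + 1), …, (i, i + k - 1)`, second index modulo `m`. -/
def circulant (m k : ℕ) : Finset (Fin m × Fin m) :=
  {p | ∃ j < k, p.2.val = (p.1.val + j) % m}

/-- `U` is the entry set `H` up to labelling: `U` arises from `H` by an injective relabelling of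
the rows and an injective relabelling of the columns (all further rows and columns of the `n × n`
matrix contain no element of `U`). -/
def IsCopyOf {m n : ℕ} (U : Finset (Fin n × Fin n)) (H : Finset (Fin m × Fin m)) : Prop :=
  ∃ (f : Fin m ↪ Fin n) (g : Fin m ↪ Fin n), U = H.map (f.prodMap g)

/-- All elements of `U` lie in the union of a single row and a single column. -/
def InRowUnionColumn {n : ℕ} (U : Finset (Fin n × Fin n)) : Prop :=
  ∃ i j : Fin n, ∀ p ∈ U, p.1 = i ∨ p.2 = j

end MatrixCompletion

/-! Both directions reduce to small matrices by Schur complements. If the rows and columns outside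
an `m × m` block form an invertible block, then passing to the Schur complement preserves corank.
Specified entries of the small block become specified entries of the complement, and free ones stay
free (`rank_eq_rank_schur_add`, `GenericallyCompletable.embed`).

View `U` as a bipartite graph on rows and columns. If `U` is nonempty and none of the three
conditions holds, then up to transposition `U` contains one of six patterns: a 4-cycle, a 4-edge
path, two disjoint cherries, a 3-edge path plus an edge, a cherry plus two edges, or five disjoint
edges. Each is generically completable to corank 2 by solving only linear equations, so real
solutions exist. Hence corank 1 is not typical.

Conversely, one free entry already gives corank 1 generically, so a nonempty open set of fillings
obstructing corank 2 is enough (`isTypicalCorank_one_of_isOpen`). The obstruction is a fully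
specified minor for a row and a column, a cubic relation for `G(3,1)`, and the negative discriminant
of a real quadratic for `G(4,1)`. -/

namespace MatrixCompletion

open MvPolynomial

/-! ### Polynomial functions on a coordinate space -/

/-- The function `F` on `ℝ^σ` is given by a polynomial. -/
def IsPoly {σ : Type} (F : (σ → ℝ) → ℝ) : Prop :=
  ∃ p : MvPolynomial σ ℝ, ∀ x, eval x p = F x

namespace IsPoly

variable {σ τ : Type} {F G : (σ → ℝ) → ℝ}

lemma coord (i : σ) : IsPoly fun x : σ → ℝ => x i := ⟨X i, fun x => by simp⟩

lemma const (c : ℝ) : IsPoly fun _ : σ → ℝ => c := ⟨C c, fun x => by simp⟩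

lemma add (hF : IsPoly F) (hG : IsPoly G) : IsPoly fun x => F x + G x := by
  obtain ⟨p, hp⟩ := hF
  obtain ⟨q, hq⟩ := hG
  exact ⟨p + q, fun x => by simp [hp, hq]⟩

lemma sub (hF : IsPoly F) (hG : IsPoly G) : IsPoly fun x => F x - G x := by
  obtain ⟨p, hp⟩ := hF
  obtain ⟨q, hq⟩ := hG
  exact ⟨p - q, fun x => by simp [hp, hq]⟩

lemma neg (hF : IsPoly F) : IsPoly fun x => -F x := by
  obtain ⟨p, hp⟩ := hF
  exact ⟨-p, fun x => by simp [hp]⟩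

lemma mul (hF : IsPoly F) (hG : IsPoly G) : IsPoly fun x => F x * G x := by
  obtain ⟨p, hp⟩ := hF
  obtain ⟨q, hq⟩ := hG
  exact ⟨p * q, fun x => by simp [hp, hq]⟩

lemma sum {ι : Type} (s : Finset ι) {H : ι → (σ → ℝ) → ℝ} (h : ∀ i, IsPoly (H i)) :
    IsPoly fun x => ∑ i ∈ s, H i x := by
  choose p hp using h
  exact ⟨∑ i ∈ s, p i, fun x => by simp [hp]⟩

lemma comp (hF : IsPoly F) {φ : (τ → ℝ) → σ → ℝ} (hφ : ∀ i, IsPoly fun x => φ x i) :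
    IsPoly fun x => F (φ x) := by
  obtain ⟨p, hp⟩ := hF
  choose q hq using hφ
  refine ⟨bind₁ q p, fun x => ?_⟩
  have h : φ x = fun i => eval x (q i) := funext fun i => (hq i x).symm
  change _ = F (φ x)
  rw [← hp, h]
  exact eval₂Hom_bind₁ (RingHom.id ℝ) x q p

lemma det {ι : Type} [Fintype ι] [DecidableEq ι] {M : (σ → ℝ) → Matrix ι ι ℝ}
    (h : ∀ i j, IsPoly fun x => M x i j) : IsPoly fun x => (M x).det := by
  choose p hp using h
  refine ⟨(Matrix.of p).det, fun x => ?_⟩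
  rw [RingHom.map_det]
  congr 1
  ext i j
  simp [hp]

lemma adjugate {ι : Type} [Fintype ι] [DecidableEq ι] {M : (σ → ℝ) → Matrix ι ι ℝ}
    (h : ∀ i j, IsPoly fun x => M x i j) (i j : ι) : IsPoly fun x => (M x).adjugate i j := by
  simp only [Matrix.adjugate_apply]
  refine det fun a b => ?_
  by_cases hab : a = j
  · subst hab
    simpa using const _
  · simpa [Matrix.updateRow_ne hab] using h a b

lemma matrixMul {ι κ l : Type} [Fintype κ] {M : (σ → ℝ) → Matrix ι κ ℝ}
    {N : (σ → ℝ) → Matrix κ l ℝ} (hM : ∀ i j, IsPoly fun x => M x i j)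
    (hN : ∀ i j, IsPoly fun x => N x i j) (i : ι) (j : l) :
    IsPoly fun x => (M x * N x) i j := by
  simp only [Matrix.mul_apply]
  exact sum _ fun k => (hM i k).mul (hN k j)

lemma continuous (hF : IsPoly F) : Continuous F := by
  obtain ⟨p, hp⟩ := hF
  rw [← funext hp]
  exact MvPolynomial.continuous_eval p

end IsPoly

/-- A nonempty open subset of `ℝ^σ` is Zariski dense. -/
lemma isZariskiDense_of_isOpen {σ : Type} [Finite σ] {O : Set (σ → ℝ)} (hO : IsOpen O)
    (hne : O.Nonempty) : IsZariskiDense O := by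
  intro f hf
  obtain ⟨x, hx⟩ := hne
  have := Fintype.ofFinite σ
  obtain ⟨ε, hε, hball⟩ := Metric.isOpen_iff.1 hO x hx
  refine MvPolynomial.funext_set (fun i => Metric.ball (x i) ε)
    (fun i => ?_) fun y hy => ?_
  · rw [Real.ball_eq_Ioo]
    exact Set.Ioo_infinite (by linarith)
  · rw [map_zero]
    refine hf y (hball ?_)
    rw [ball_pi x hε]
    exact hy

/-! ### Schur complements -/

/-- The Schur complement of the block `E`, multiplied by `det E`. -/
def schur {m k : ℕ} (M : Matrix (Fin m ⊕ Fin k) (Fin m ⊕ Fin k) ℝ) : Matrix (Fin m) (Fin m) ℝ :=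
  M.toBlocks₂₂.det • M.toBlocks₁₁ - M.toBlocks₁₂ * M.toBlocks₂₂.adjugate * M.toBlocks₂₁

/-- The lower block of equations determines `y = -E⁻¹Cx`. Thus the kernel of the block matrix
projects isomorphically onto that of the Schur complement, and rank-nullity gives the rest. -/
lemma rank_fromBlocks {m k : ℕ} (X : Matrix (Fin m) (Fin m) ℝ) (B : Matrix (Fin m) (Fin k) ℝ)
    (C : Matrix (Fin k) (Fin m) ℝ) (E : Matrix (Fin k) (Fin k) ℝ) (hE : IsUnit E.det) :
    (Matrix.fromBlocks X B C E).rank = (X - B * E⁻¹ * C).rank + k := by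
  have key : Module.finrank ℝ (LinearMap.ker (Matrix.fromBlocks X B C E).mulVecLin) =
      Module.finrank ℝ (LinearMap.ker (X - B * E⁻¹ * C).mulVecLin) := by
    have hsol : ∀ (x : Fin m → ℝ) (y : Fin k → ℝ), C.mulVec x + E.mulVec y = 0 →
        y = -(E⁻¹.mulVec (C.mulVec x)) := by
      intro x y h
      have h' := congrArg (E⁻¹.mulVec) (eq_neg_of_add_eq_zero_right h)
      rw [Matrix.mulVec_mulVec, Matrix.nonsing_inv_mul _ hE, Matrix.one_mulVec,
        Matrix.mulVec_neg] at h'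
      exact h'
    have hker : ∀ v : Fin m ⊕ Fin k → ℝ, (Matrix.fromBlocks X B C E).mulVec v = 0 ↔
        X.mulVec (v ∘ Sum.inl) + B.mulVec (v ∘ Sum.inr) = 0 ∧
        C.mulVec (v ∘ Sum.inl) + E.mulVec (v ∘ Sum.inr) = 0 := by
      intro v
      rw [Matrix.fromBlocks_mulVec, ← Sum.elim_zero_zero, Sum.elim_eq_iff]
    apply le_antisymm
    · let φ : (Fin m ⊕ Fin k → ℝ) →ₗ[ℝ] (Fin m → ℝ) := LinearMap.funLeft ℝ ℝ Sum.inl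
      refine LinearMap.finrank_le_finrank_of_injective (f := φ.restrict ?_) ?_
      · intro v hv
        obtain ⟨h1, h2⟩ := (hker v).1 hv
        rw [hsol _ _ h2] at h1
        simp only [LinearMap.mem_ker, Matrix.mulVecLin_apply, Matrix.sub_mulVec,
          ← Matrix.mulVec_mulVec]
        rw [Matrix.mulVec_neg] at h1
        exact h1
      · rw [injective_iff_map_eq_zero]
        rintro ⟨v, hv⟩ h
        have h0 : v ∘ Sum.inl = 0 := congrArg Subtype.val h
        obtain ⟨h1, h2⟩ := (hker v).1 hv
        have h3 := hsol _ _ h2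
        rw [h0] at h3
        ext i
        rcases i with i | i
        · exact congrFun h0 i
        · simpa using congrFun h3 i
    · let ψ : (Fin m → ℝ) →ₗ[ℝ] (Fin m ⊕ Fin k → ℝ) :=
        { toFun := fun x => Sum.elim x (-(E⁻¹.mulVec (C.mulVec x)))
          map_add' := fun x y => by
            ext i; rcases i with i | i <;> simp [Matrix.mulVec_add, add_comm]
          map_smul' := fun c x => by
            ext i; rcases i with i | i <;> simp [Matrix.mulVec_smul] }
      refine LinearMap.finrank_le_finrank_of_injective (f := ψ.restrict ?_) ?_
      · intro x hx
        simp only [LinearMap.mem_ker, Matrix.mulVecLin_apply, Matrix.sub_mulVec,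
          ← Matrix.mulVec_mulVec] at hx
        refine (hker _).2 ⟨?_, ?_⟩
        · simpa [ψ, Matrix.mulVec_neg, sub_eq_add_neg] using hx
        · simp [ψ, Matrix.mulVec_neg, Matrix.mulVec_mulVec, Matrix.mul_nonsing_inv_cancel_left _ _ hE]
      · rw [injective_iff_map_eq_zero]
        rintro ⟨x, hx⟩ h
        have h0 := congrArg Subtype.val h
        ext i
        exact congrFun h0 (Sum.inl i)
  have h1 := LinearMap.finrank_range_add_finrank_ker (Matrix.fromBlocks X B C E).mulVecLin
  have h2 := LinearMap.finrank_range_add_finrank_ker (X - B * E⁻¹ * C).mulVecLin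
  simp only [Module.finrank_fintype_fun_eq_card, Fintype.card_sum, Fintype.card_fin] at h1 h2
  unfold Matrix.rank
  omega

/-- Scaling by `det E` does not affect the rank, and it makes the complement polynomial in the
entries of `M`. -/
lemma rank_eq_rank_schur_add {m k : ℕ} (M : Matrix (Fin m ⊕ Fin k) (Fin m ⊕ Fin k) ℝ)
    (hE : M.toBlocks₂₂.det ≠ 0) : M.rank = (schur M).rank + k := by
  conv_lhs => rw [← Matrix.fromBlocks_toBlocks M]
  rw [rank_fromBlocks _ _ _ _ (isUnit_iff_ne_zero.2 hE), 
    ← Matrix.rank_smul_of_mem_nonZeroDivisors _ (mem_nonZeroDivisors_of_ne_zero hE)]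
  rw [schur, smul_sub, Matrix.inv_def, Ring.inverse_eq_inv', Matrix.mul_smul, Matrix.smul_mul,
    smul_smul, mul_inv_cancel₀ hE, one_smul]

/-! ### Generic completability -/

/-- Outside a proper algebraic subset, the entries of an `I × J` matrix that lie in `U` can be
changed in such a way that the rank becomes at most `r`. -/
def GenericallyCompletable {I J : Type} [Fintype I] [Fintype J] (U : Set (I × J)) (r : ℕ) : Prop :=
  ∃ F : (I × J → ℝ) → ℝ, IsPoly F ∧ (∃ x, F x ≠ 0) ∧ ∀ x, F x ≠ 0 →
    ∃ M : Matrix I J ℝ, (∀ p ∉ U, M p.1 p.2 = x p) ∧ M.rank ≤ r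

namespace GenericallyCompletable

lemma transpose {I J : Type} [Fintype I] [Fintype J] {U : Set (I × J)} {r : ℕ}
    (h : GenericallyCompletable U r) :
    GenericallyCompletable (Prod.swap ⁻¹' U : Set (J × I)) r := by
  obtain ⟨F, hF, ⟨x, hx⟩, h⟩ := h
  refine ⟨fun y => F (y ∘ Prod.swap), hF.comp fun i => IsPoly.coord _, ⟨x ∘ Prod.swap, ?_⟩,
    fun y hy => ?_⟩
  · simpa [Function.comp_def] using hx
  · obtain ⟨M, hM, hr⟩ := h _ hy
    refine ⟨M.transpose, fun p hp => ?_, by rwa [Matrix.rank_transpose]⟩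
    simpa using hM p.swap hp

end GenericallyCompletable

lemma exists_equiv_sum {m n : ℕ} (f : Fin m ↪ Fin n) :
    ∃ e : Fin n ≃ Fin m ⊕ Fin (n - m), ∀ i, e (f i) = Sum.inl i := by
  classical
  have hcard : Fintype.card ↑(Set.range f)ᶜ = n - m := by
    rw [Fintype.card_compl_set, Fintype.card_fin, Set.card_range_of_injective f.injective,
      Fintype.card_fin]
  refine ⟨(Equiv.Set.sumCompl (Set.range f)).symm.trans
    (Equiv.sumCongr (Equiv.ofInjective f f.injective).symm (Fintype.equivFinOfCardEq hcard)),
    fun i => ?_⟩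
  simp [Equiv.Set.sumCompl_symm_apply_of_mem (Set.mem_range_self i),
    Equiv.ofInjective_symm_apply]

lemma schur_fromBlocks {m k : ℕ} (X : Matrix (Fin m) (Fin m) ℝ) (B : Matrix (Fin m) (Fin k) ℝ)
    (C : Matrix (Fin k) (Fin m) ℝ) (E : Matrix (Fin k) (Fin k) ℝ) :
    schur (Matrix.fromBlocks X B C E) = E.det • X - B * E.adjugate * C := by
  simp [schur]

lemma isPoly_schur {σ : Type} {m k : ℕ}
    {M : (σ → ℝ) → Matrix (Fin m ⊕ Fin k) (Fin m ⊕ Fin k) ℝ}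
    (h : ∀ i j, IsPoly fun x => M x i j) (i j : Fin m) : IsPoly fun x => schur (M x) i j := by
  simp only [schur, Matrix.sub_apply, Matrix.smul_apply, smul_eq_mul]
  refine ((IsPoly.det fun a b => h (.inr a) (.inr b)).mul (h (.inl i) (.inl j))).sub ?_
  exact IsPoly.matrixMul (IsPoly.matrixMul (fun a b => h (.inl a) (.inr b))
    (IsPoly.adjugate fun a b => h (.inr a) (.inr b))) (fun a b => h (.inr a) (.inl b)) i j

/-- Generic completability of a small square pattern carries over to larger square matrices. -/
lemma GenericallyCompletable.embed {m n r : ℕ} {V : Set (Fin m × Fin m)}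
    (hV : GenericallyCompletable V r) (f g : Fin m ↪ Fin n) {U : Set (Fin n × Fin n)}
    (hU : ∀ p ∈ V, (f p.1, g p.2) ∈ U) : GenericallyCompletable U (r + (n - m)) := by
  obtain ⟨F, hF, ⟨x₀, hx₀⟩, h⟩ := hV
  obtain ⟨e₁, he₁⟩ := exists_equiv_sum f
  obtain ⟨e₂, he₂⟩ := exists_equiv_sum g
  let A : (Fin n × Fin n → ℝ) → Matrix (Fin m ⊕ Fin (n - m)) (Fin m ⊕ Fin (n - m)) ℝ :=
    fun x => .of fun a b => x (e₁.symm a, e₂.symm b)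
  have hA : ∀ i j, IsPoly fun x => A x i j := fun i j => IsPoly.coord _
  refine ⟨fun x => (A x).toBlocks₂₂.det * F fun p => schur (A x) p.1 p.2,
    (IsPoly.det fun a b => hA (.inr a) (.inr b)).mul (hF.comp fun p => isPoly_schur hA p.1 p.2),
    ⟨fun p => Matrix.fromBlocks (.of fun i j => x₀ (i, j)) 0 0 1 (e₁ p.1) (e₂ p.2), ?_⟩,
    fun x hx => ?_⟩
  · have h1 : (A fun p => Matrix.fromBlocks (.of fun i j => x₀ (i, j)) 0 0 1 (e₁ p.1) (e₂ p.2)) =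
        Matrix.fromBlocks (.of fun i j => x₀ (i, j)) 0 0 1 := by
      ext a b
      simp [A]
    simp only [h1, schur_fromBlocks]
    simpa using hx₀
  · obtain ⟨hd, hS⟩ := mul_ne_zero_iff.1 hx
    obtain ⟨Y, hY, hr⟩ := h _ hS
    set E := (A x).toBlocks₂₂
    set B := (A x).toBlocks₁₂
    set C := (A x).toBlocks₂₁
    -- The upper left block is chosen so that the scaled Schur complement of `M` is exactly `Y`.
    let M := Matrix.fromBlocks (E.det⁻¹ • (Y + B * E.adjugate * C)) B C E
    refine ⟨M.submatrix e₁ e₂, fun p hp => ?_, ?_⟩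
    · obtain ⟨i, j⟩ := p
      obtain ⟨a, rfl⟩ := e₁.symm.surjective i
      obtain ⟨b, rfl⟩ := e₂.symm.surjective j
      rcases a with a | a <;> rcases b with b | b
      · have hab : (a, b) ∉ V := fun hab => hp (by
          have := hU _ hab
          rwa [← e₁.symm_apply_apply (f a), ← e₂.symm_apply_apply (g b), he₁, he₂] at this)
        have hYab : Y a b = E.det * x (e₁.symm (.inl a), e₂.symm (.inl b)) -
          (B * E.adjugate * C) a b := hY (a, b) hab
        simp only [M, Matrix.submatrix_apply, Equiv.apply_symm_apply, Matrix.fromBlocks_apply₁₁,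
          Matrix.smul_apply, Matrix.add_apply, hYab, sub_add_cancel, smul_eq_mul]
        rw [inv_mul_cancel_left₀ hd]
      all_goals
        simp only [M, Matrix.submatrix_apply, Equiv.apply_symm_apply, Matrix.fromBlocks_apply₁₂,
          Matrix.fromBlocks_apply₂₁, Matrix.fromBlocks_apply₂₂]
        rfl
    · rw [Matrix.rank_submatrix, rank_eq_rank_schur_add M (by simpa [M] using hd)]
      gcongr
      have : schur M = Y := by
        rw [schur_fromBlocks, smul_smul, mul_inv_cancel₀ hd, one_smul, add_sub_cancel_right]
      rwa [this]

/-! ### Small patterns -/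

lemma genericallyCompletable_univ (m : ℕ) :
    GenericallyCompletable (Set.univ : Set (Fin m × Fin m)) 0 :=
  ⟨fun _ => 1, IsPoly.const 1, ⟨0, one_ne_zero⟩, fun _ _ =>
    ⟨0, fun p hp => absurd (Set.mem_univ p) hp, by simp⟩⟩

/-- Cramer's rule for two equations. -/
lemma exists_solution_two {a b c d : ℝ} (h : a * d - b * c ≠ 0) (e f : ℝ) :
    ∃ p q, p * a + q * b = e ∧ p * c + q * d = f ∧
      p * (a * d - b * c) = e * d - b * f ∧ q * (a * d - b * c) = a * f - e * c := by
  refine ⟨(e * d - b * f) / (a * d - b * c), (a * f - e * c) / (a * d - b * c), ?_, ?_,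
    div_mul_cancel₀ _ h, div_mul_cancel₀ _ h⟩
  · rw [div_mul_eq_mul_div, div_mul_eq_mul_div, ← add_div, div_eq_iff h]
    ring
  · rw [div_mul_eq_mul_div, div_mul_eq_mul_div, ← add_div, div_eq_iff h]
    ring

/-- Cramer's rule for three equations. -/
lemma exists_solution_three {a₁ a₂ a₃ b₁ b₂ b₃ c₁ c₂ c₃ : ℝ}
    (h : a₁ * (b₂ * c₃ - b₃ * c₂) - a₂ * (b₁ * c₃ - b₃ * c₁) + a₃ * (b₁ * c₂ - b₂ * c₁) ≠ 0)
    (e f g : ℝ) :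
    ∃ p q r, a₁ * p + (a₂ * q + a₃ * r) = e ∧ b₁ * p + (b₂ * q + b₃ * r) = f ∧
      c₁ * p + (c₂ * q + c₃ * r) = g ∧
      p * (a₁ * (b₂ * c₃ - b₃ * c₂) - a₂ * (b₁ * c₃ - b₃ * c₁) + a₃ * (b₁ * c₂ - b₂ * c₁)) =
        e * (b₂ * c₃ - b₃ * c₂) - a₂ * (f * c₃ - b₃ * g) + a₃ * (f * c₂ - b₂ * g) := by
  set D := a₁ * (b₂ * c₃ - b₃ * c₂) - a₂ * (b₁ * c₃ - b₃ * c₁) + a₃ * (b₁ * c₂ - b₂ * c₁) with hD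
  refine ⟨(e * (b₂ * c₃ - b₃ * c₂) - a₂ * (f * c₃ - b₃ * g) + a₃ * (f * c₂ - b₂ * g)) / D,
    (a₁ * (f * c₃ - b₃ * g) - e * (b₁ * c₃ - b₃ * c₁) + a₃ * (b₁ * g - f * c₁)) / D,
    (a₁ * (b₂ * g - f * c₂) - a₂ * (b₁ * g - f * c₁) + e * (b₁ * c₂ - b₂ * c₁)) / D,
    ?_, ?_, ?_, div_mul_cancel₀ _ h⟩ <;>
  · rw [mul_div_assoc', mul_div_assoc', mul_div_assoc', ← add_div, ← add_div, div_eq_iff h, hD]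
    ring

/-- The last row is fully specified and each other row has one specified entry, which fixes its
multiple of the last row. -/
lemma genericallyCompletable_path :
    GenericallyCompletable ({(0, 0), (0, 1), (1, 1), (1, 2)} : Set (Fin 3 × Fin 3)) 1 := by
  refine ⟨fun x => x (2, 2) * x (2, 0), (IsPoly.coord _).mul (IsPoly.coord _), ⟨fun _ => 1, by simp⟩,
    fun x hx => ?_⟩
  obtain ⟨h2, h0⟩ := mul_ne_zero_iff.1 hx
  refine ⟨Matrix.vecMulVec ![x (0, 2) / x (2, 2), x (1, 0) / x (2, 0), 1]
    ![x (2, 0), x (2, 1), x (2, 2)], ?_, Matrix.rank_vecMulVec_le _ _⟩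
  rintro ⟨i, j⟩ hp
  fin_cases i <;> fin_cases j <;> simp [Matrix.vecMulVec_apply] at hp ⊢ <;> field_simp

/-- Rows 2 and 3 are fully specified. Each of rows 0 and 1 has two specified entries, which fix it
as a combination of those two. -/
lemma genericallyCompletable_two_pairs :
    GenericallyCompletable ({(0, 0), (0, 1), (1, 2), (1, 3)} : Set (Fin 4 × Fin 4)) 2 := by
  refine ⟨fun x => (x (2, 2) * x (3, 3) - x (3, 2) * x (2, 3)) *
    (x (2, 0) * x (3, 1) - x (3, 0) * x (2, 1)), ?_,
    ⟨fun p => (!![0, 0, 0, 0; 0, 0, 0, 0; 1, 0, 1, 0; 0, 1, 0, 1] : Matrix _ _ ℝ) p.1 p.2,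
      by simp⟩, fun x hx => ?_⟩
  · repeat' first | exact IsPoly.coord _ | apply IsPoly.mul | apply IsPoly.sub
  obtain ⟨h0, h1⟩ := mul_ne_zero_iff.1 hx
  obtain ⟨p, q, e1, e2, -⟩ := exists_solution_two h0 (x (0, 2)) (x (0, 3))
  obtain ⟨r, s, e3, e4, -⟩ := exists_solution_two h1 (x (1, 0)) (x (1, 1))
  refine ⟨!![p, q; r, s; 1, 0; 0, 1] *
    !![x (2, 0), x (2, 1), x (2, 2), x (2, 3); x (3, 0), x (3, 1), x (3, 2), x (3, 3)], ?_,
    (Matrix.rank_mul_le_left _ _).trans (Matrix.rank_le_width _)⟩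
  rintro ⟨i, j⟩ hp
  fin_cases i <;> fin_cases j <;> simp [Matrix.mul_apply, Fin.sum_univ_succ] at hp ⊢ <;> assumption

lemma genericallyCompletable_path_add_edge :
    GenericallyCompletable ({(0, 0), (0, 1), (1, 1), (2, 2)} : Set (Fin 3 × Fin 3)) 1 := by
  refine ⟨fun x => x (1, 0) * x (2, 0) * x (1, 2),
    ((IsPoly.coord _).mul (IsPoly.coord _)).mul (IsPoly.coord _), ⟨fun _ => 1, by simp⟩,
    fun x hx => ?_⟩
  obtain ⟨h, h2⟩ := mul_ne_zero_iff.1 hx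
  obtain ⟨h0, h1⟩ := mul_ne_zero_iff.1 h
  refine ⟨Matrix.vecMulVec ![x (0, 2) * x (1, 0) / (x (1, 2) * x (2, 0)), x (1, 0) / x (2, 0), 1]
    ![x (2, 0), x (2, 1), x (1, 2) * x (2, 0) / x (1, 0)], ?_, Matrix.rank_vecMulVec_le _ _⟩
  rintro ⟨i, j⟩ hp
  fin_cases i <;> fin_cases j <;> simp [Matrix.vecMulVec_apply] at hp ⊢ <;> field_simp

/-- Columns 0 and 3 span. Rows 2, 3 express column 1 through them and rows 1, 3 express column 2.
The free entries `p`, `q` of row 0 then solve a 2 × 2 linear system, whose determinant is the last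
factor of the polynomial up to the other two. -/
lemma genericallyCompletable_cherry_add_two_edges :
    GenericallyCompletable ({(0, 0), (0, 3), (1, 1), (2, 2)} : Set (Fin 4 × Fin 4)) 2 := by
  refine ⟨fun x => (x (2, 0) * x (3, 3) - x (2, 3) * x (3, 0)) *
      (x (1, 0) * x (3, 3) - x (1, 3) * x (3, 0)) *
      ((x (2, 1) * x (3, 3) - x (2, 3) * x (3, 1)) * (x (1, 0) * x (3, 2) - x (1, 2) * x (3, 0)) -
        (x (2, 0) * x (3, 1) - x (2, 1) * x (3, 0)) * (x (1, 2) * x (3, 3) - x (1, 3) * x (3, 2))),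
    ?_, ⟨fun p => (!![0, 0, 0, 0; 1, 0, 1, 0; 1, 0, 0, 0; 0, 1, 0, 1] : Matrix _ _ ℝ) p.1 p.2,
      by simp⟩, fun x hx => ?_⟩
  · repeat' first | exact IsPoly.coord _ | apply IsPoly.mul | apply IsPoly.sub
  obtain ⟨h, hD⟩ := mul_ne_zero_iff.1 hx
  obtain ⟨h1, h2⟩ := mul_ne_zero_iff.1 h
  obtain ⟨α, β, e1, e2, hα, hβ⟩ := exists_solution_two h1 (x (2, 1)) (x (3, 1))
  obtain ⟨γ, δ, e3, e4, hγ, hδ⟩ := exists_solution_two h2 (x (1, 2)) (x (3, 2))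
  have hD' : α * δ - β * γ ≠ 0 := fun h0 => hD (by
    rw [← hα, ← hβ, ← hγ, ← hδ]
    linear_combination (x (2, 0) * x (3, 3) - x (2, 3) * x (3, 0)) *
      (x (1, 0) * x (3, 3) - x (1, 3) * x (3, 0)) * h0)
  obtain ⟨p, q, e5, e6, -⟩ := exists_solution_two hD' (x (0, 1)) (x (0, 2))
  refine ⟨!![p, q; x (1, 0), x (1, 3); x (2, 0), x (2, 3); x (3, 0), x (3, 3)] *
    !![1, α, γ, 0; 0, β, δ, 1], ?_,
    (Matrix.rank_mul_le_left _ _).trans (Matrix.rank_le_width _)⟩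
  rintro ⟨i, j⟩ hp
  fin_cases i <;> fin_cases j <;> simp [Matrix.mul_apply, Fin.sum_univ_succ] at hp ⊢ <;>
    linarith

/-- Columns 1, 3, 4 span. The vector `w` is the cross product of rows 0 and 1 in columns 2, 3, 4;
the entries `y₃`, `y₄` make rows 3 and 4 orthogonal to it, and the free entry (2,2) does so for row
2, so column 2 depends on columns 3 and 4. Column 0 is `β`, `γ`, `δ` times columns 1, 3, 4, as fixed
by rows 2, 3, 4; entry (0,0) is free, and row 1 is met by solving for entry (1,1), which needs `β ≠
0`. -/
lemma genericallyCompletable_diagonal_five :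
    GenericallyCompletable ({p | p.1 = p.2} : Set (Fin 5 × Fin 5)) 3 := by
  let w₂ : (Fin 5 × Fin 5 → ℝ) → ℝ := fun x => x (0, 3) * x (1, 4) - x (0, 4) * x (1, 3)
  let w₃ : (Fin 5 × Fin 5 → ℝ) → ℝ := fun x => x (0, 4) * x (1, 2) - x (0, 2) * x (1, 4)
  let w₄ : (Fin 5 × Fin 5 → ℝ) → ℝ := fun x => x (0, 2) * x (1, 3) - x (0, 3) * x (1, 2)
  let Y₃ : (Fin 5 × Fin 5 → ℝ) → ℝ := fun x => -(x (3, 2) * w₂ x + x (3, 4) * w₄ x)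
  let Y₄ : (Fin 5 × Fin 5 → ℝ) → ℝ := fun x => -(x (4, 2) * w₂ x + x (4, 3) * w₃ x)
  let D : Fin 5 → (Fin 5 × Fin 5 → ℝ) → ℝ := fun i x =>
    x (2, i) * (Y₃ x * Y₄ x - x (3, 4) * x (4, 3) * w₃ x * w₄ x) -
    x (2, 3) * (x (3, i) * Y₄ x * w₃ x - x (3, 4) * x (4, i) * w₃ x * w₄ x) +
    x (2, 4) * (x (3, i) * x (4, 3) * w₃ x * w₄ x - Y₃ x * w₄ x * x (4, i))
  have hw₂ : IsPoly w₂ := by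
    repeat' first | exact IsPoly.coord _ | apply IsPoly.mul | apply IsPoly.sub
  have hw₃ : IsPoly w₃ := by
    repeat' first | exact IsPoly.coord _ | apply IsPoly.mul | apply IsPoly.sub
  have hw₄ : IsPoly w₄ := by
    repeat' first | exact IsPoly.coord _ | apply IsPoly.mul | apply IsPoly.sub
  have hY₃ : IsPoly Y₃ := (((IsPoly.coord _).mul hw₂).add ((IsPoly.coord _).mul hw₄)).neg
  have hY₄ : IsPoly Y₄ := (((IsPoly.coord _).mul hw₂).add ((IsPoly.coord _).mul hw₃)).neg
  have hD : ∀ i, IsPoly (D i) := fun i => by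
    repeat' first
      | exact IsPoly.coord _ | assumption | apply IsPoly.mul | apply IsPoly.sub | apply IsPoly.add
  refine ⟨fun x => w₂ x * w₃ x * w₄ x * D 1 x * D 0 x,
    (((hw₂.mul hw₃).mul hw₄).mul (hD 1)).mul (hD 0),
    ⟨fun p => (!![0, 0, 0, -1, -1; 0, 0, -1, 0, -1; 0, 0, 0, 0, -1; 0, 0, 0, 0, -1;
      1, 1, 0, 0, 0] : Matrix _ _ ℝ) p.1 p.2, by simp [D, Y₃, Y₄, w₂, w₃, w₄]⟩, fun x hx => ?_⟩
  simp only [mul_ne_zero_iff] at hx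
  obtain ⟨⟨⟨⟨h2, h3⟩, h4⟩, hD1⟩, hD0⟩ := hx
  obtain ⟨y₃, hy₃⟩ : ∃ y, y * w₃ x = Y₃ x := ⟨Y₃ x / w₃ x, by field_simp⟩
  obtain ⟨y₄, hy₄⟩ : ∃ y, y * w₄ x = Y₄ x := ⟨Y₄ x / w₄ x, by field_simp⟩
  have hk0 : x (0, 2) * w₂ x + x (0, 3) * w₃ x + x (0, 4) * w₄ x = 0 := by
    simp only [w₂, w₃, w₄]; ring
  have hk1 : x (1, 2) * w₂ x + x (1, 3) * w₃ x + x (1, 4) * w₄ x = 0 := by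
    simp only [w₂, w₃, w₄]; ring
  have hk3 : x (3, 2) * w₂ x + y₃ * w₃ x + x (3, 4) * w₄ x = 0 := by
    rw [hy₃]; simp only [Y₃]; ring
  have hk4 : x (4, 2) * w₂ x + x (4, 3) * w₃ x + y₄ * w₄ x = 0 := by
    rw [hy₄]; simp only [Y₄]; ring
  -- The minor of rows 2, 3, 4 and columns `i`, 3, 4. `D i` is this minor with denominators cleared,
  -- and `β` is `d 0 / d 1`.
  let d : Fin 5 → ℝ := fun i => x (2, i) * (y₃ * y₄ - x (3, 4) * x (4, 3)) -
    x (2, 3) * (x (3, i) * y₄ - x (3, 4) * x (4, i)) +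
    x (2, 4) * (x (3, i) * x (4, 3) - y₃ * x (4, i))
  have hd : ∀ i, d i * (w₃ x * w₄ x) = D i x := fun i => by
    simp only [D, ← hy₃, ← hy₄, d]; ring
  have hd1 : d 1 ≠ 0 := fun h => hD1 (by rw [← hd, h, zero_mul])
  have hd0 : d 0 ≠ 0 := fun h => hD0 (by rw [← hd, h, zero_mul])
  clear_value w₂ w₃ w₄ Y₃ Y₄ D
  obtain ⟨β, γ, δ, e2, e3, e4, hβ⟩ := exists_solution_three hd1 (x (2, 0)) (x (3, 0)) (x (4, 0))
  have hβ0 : β ≠ 0 := fun h => hd0 (by rw [h, zero_mul] at hβ; exact hβ.symm)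
  refine ⟨!![x (0, 1), x (0, 3), x (0, 4);
      (x (1, 0) - γ * x (1, 3) - δ * x (1, 4)) / β, x (1, 3), x (1, 4);
      x (2, 1), x (2, 3), x (2, 4); x (3, 1), y₃, x (3, 4); x (4, 1), x (4, 3), y₄] *
    !![β, 1, 0, 0, 0; γ, 0, -w₃ x / w₂ x, 1, 0; δ, 0, -w₄ x / w₂ x, 0, 1], ?_,
    (Matrix.rank_mul_le_left _ _).trans (Matrix.rank_le_width _)⟩
  rintro ⟨i, j⟩ hp
  fin_cases i <;> fin_cases j <;> simp [Matrix.mul_apply, Fin.sum_univ_succ] at hp ⊢ <;>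
    first | assumption | (field_simp; linarith)

/-! ### Patterns contained in a set of unspecified entries -/

/-- The entries in `U` can generically be chosen such that the corank is at least two. -/
def IsCorankTwoCompletable {n : ℕ} (U : Set (Fin n × Fin n)) : Prop :=
  ∃ r : ℕ, r + 2 = n ∧ GenericallyCompletable U r

namespace IsCorankTwoCompletable

variable {n : ℕ} {U : Set (Fin n × Fin n)}

lemma of_swap (h : IsCorankTwoCompletable (Prod.swap ⁻¹' U)) : IsCorankTwoCompletable U := by
  obtain ⟨r, hr, h⟩ := h
  exact ⟨r, hr, h.transpose⟩

lemma of_pattern {m r : ℕ} {V : Set (Fin m × Fin m)} (hV : GenericallyCompletable V r)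
    (hr : r + 2 = m) {f g : Fin m → Fin n} (hf : f.Injective) (hg : g.Injective)
    (hU : ∀ p ∈ V, (f p.1, g p.2) ∈ U) : IsCorankTwoCompletable U := by
  have hmn : m ≤ n := by simpa using Fintype.card_le_of_injective f hf
  exact ⟨r + (n - m), by omega, hV.embed ⟨f, hf⟩ ⟨g, hg⟩ hU⟩

lemma injective_two {α : Type} {a b : α} (h : a ≠ b) : Function.Injective ![a, b] := by
  intro i j hij
  fin_cases i <;> fin_cases j <;> simp_all

lemma injective_three {α : Type} {a b c : α} (hab : a ≠ b) (hac : a ≠ c) (hbc : b ≠ c) :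
    Function.Injective ![a, b, c] := by
  intro i j hij
  have := hab.symm
  have := hac.symm
  have := hbc.symm
  fin_cases i <;> fin_cases j <;> simp_all

lemma injective_four {α : Type} {a b c d : α} (hab : a ≠ b) (hac : a ≠ c) (had : a ≠ d)
    (hbc : b ≠ c) (hbd : b ≠ d) (hcd : c ≠ d) : Function.Injective ![a, b, c, d] := by
  intro i j hij
  have := hab.symm
  have := hac.symm
  have := had.symm
  have := hbc.symm
  have := hbd.symm
  have := hcd.symm
  fin_cases i <;> fin_cases j <;> simp_all

lemma of_path {a b c d e : Fin n} (hab : a ≠ b) (hcd : c ≠ d) (hce : c ≠ e) (hde : d ≠ e)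
    (h₁ : (a, c) ∈ U) (h₂ : (a, d) ∈ U) (h₃ : (b, d) ∈ U) (h₄ : (b, e) ∈ U) :
    IsCorankTwoCompletable U := by
  -- Rows and columns share the index type `Fin n`, so three distinct columns guarantee a third row.
  obtain ⟨z, -, hz⟩ := Finset.exists_mem_notMem_of_card_lt_card
    (s := {a, b}) (t := {c, d, e}) (by simp [hab, hcd, hce, hde])
  simp only [Finset.mem_insert, Finset.mem_singleton, not_or] at hz
  refine of_pattern genericallyCompletable_path rfl
    (injective_three hab (Ne.symm hz.1) (Ne.symm hz.2)) (injective_three hcd hce hde) ?_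
  rintro p (rfl | rfl | rfl | rfl) <;> simpa

lemma of_two_pairs {a b c d e f : Fin n} (hab : a ≠ b) (hcd : c ≠ d) (hce : c ≠ e) (hcf : c ≠ f)
    (hde : d ≠ e) (hdf : d ≠ f) (hef : e ≠ f)
    (h₁ : (a, c) ∈ U) (h₂ : (a, d) ∈ U) (h₃ : (b, e) ∈ U) (h₄ : (b, f) ∈ U) :
    IsCorankTwoCompletable U := by
  obtain ⟨y, -, hy⟩ := Finset.exists_mem_notMem_of_card_lt_card
    (s := {a, b}) (t := {c, d, e}) (by simp [hab, hcd, hce, hde])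
  simp only [Finset.mem_insert, Finset.mem_singleton, not_or] at hy
  obtain ⟨z, -, hz⟩ := Finset.exists_mem_notMem_of_card_lt_card
    (s := {a, b, y}) (t := {c, d, e, f})
    (by simp [hab, hcd, hce, hcf, hde, hdf, hef, Ne.symm hy.1, Ne.symm hy.2])
  simp only [Finset.mem_insert, Finset.mem_singleton, not_or] at hz
  refine of_pattern genericallyCompletable_two_pairs rfl
    (injective_four hab (Ne.symm hy.1) (Ne.symm hz.1) (Ne.symm hy.2) (Ne.symm hz.2.1)
      (Ne.symm hz.2.2)) (injective_four hcd hce hcf hde hdf hef) ?_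
  rintro p (rfl | rfl | rfl | rfl) <;> simpa

lemma of_square {a b c d : Fin n} (hab : a ≠ b) (hcd : c ≠ d)
    (h₁ : (a, c) ∈ U) (h₂ : (a, d) ∈ U) (h₃ : (b, c) ∈ U) (h₄ : (b, d) ∈ U) :
    IsCorankTwoCompletable U := by
  refine of_pattern (genericallyCompletable_univ 2) rfl (injective_two hab) (injective_two hcd) ?_
  rintro ⟨i, j⟩ -
  fin_cases i <;> fin_cases j <;> simpa

lemma of_two_rows {a b c c' d d' : Fin n} (hab : a ≠ b) (hc : c ≠ c') (hd : d ≠ d')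
    (h₁ : (a, c) ∈ U) (h₂ : (a, c') ∈ U) (h₃ : (b, d) ∈ U) (h₄ : (b, d') ∈ U) :
    IsCorankTwoCompletable U := by
  by_cases hcd : c = d
  · subst hcd
    by_cases hcd' : c' = d'
    · subst hcd'
      exact of_square hab hc h₁ h₂ h₃ h₄
    · exact of_path hab hc.symm hcd' hd h₂ h₁ h₃ h₄
  by_cases hcd' : c = d'
  · subst hcd'
    by_cases hcd'' : c' = d
    · subst hcd''
      exact of_square hab hc h₁ h₂ h₄ h₃
    · exact of_path hab hc.symm hcd'' hd.symm h₂ h₁ h₄ h₃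
  by_cases hcd₁ : c' = d
  · subst hcd₁
    exact of_path hab hc hcd' hd h₁ h₂ h₃ h₄
  by_cases hcd₂ : c' = d'
  · subst hcd₂
    exact of_path hab hc hcd hd.symm h₁ h₂ h₄ h₃
  exact of_two_pairs hab hc hcd hcd' hcd₁ hcd₂ hd h₁ h₂ h₃ h₄

lemma of_two_columns {a b c c' d d' : Fin n} (hab : a ≠ b) (hc : c ≠ c') (hd : d ≠ d')
    (h₁ : (c, a) ∈ U) (h₂ : (c', a) ∈ U) (h₃ : (d, b) ∈ U) (h₄ : (d', b) ∈ U) :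
    IsCorankTwoCompletable U :=
  of_swap (of_two_rows hab hc hd h₁ h₂ h₃ h₄)

lemma of_cherry_add_two_edges {a b c p q r s : Fin n} (hab : a ≠ b) (hac : a ≠ c) (hbc : b ≠ c)
    (hpq : p ≠ q) (hpr : p ≠ r) (hps : p ≠ s) (hqr : q ≠ r) (hqs : q ≠ s) (hrs : r ≠ s)
    (h₁ : (a, p) ∈ U) (h₂ : (a, s) ∈ U) (h₃ : (b, q) ∈ U) (h₄ : (c, r) ∈ U) :
    IsCorankTwoCompletable U := by
  obtain ⟨z, -, hz⟩ := Finset.exists_mem_notMem_of_card_lt_card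
    (s := {a, b, c}) (t := {p, q, r, s}) (by simp [hab, hac, hbc, hpq, hpr, hps, hqr, hqs, hrs])
  simp only [Finset.mem_insert, Finset.mem_singleton, not_or] at hz
  refine of_pattern genericallyCompletable_cherry_add_two_edges rfl
    (injective_four hab hac (Ne.symm hz.1) hbc (Ne.symm hz.2.1) (Ne.symm hz.2.2))
    (injective_four hpq hpr hps hqr hqs hrs) ?_
  rintro x (rfl | rfl | rfl | rfl) <;> simpa

lemma of_path_add_edge {a b c p q r : Fin n} (hab : a ≠ b) (hac : a ≠ c) (hbc : b ≠ c)
    (hpq : p ≠ q) (hpr : p ≠ r) (hqr : q ≠ r)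
    (h₁ : (a, p) ∈ U) (h₂ : (a, q) ∈ U) (h₃ : (b, q) ∈ U) (h₄ : (c, r) ∈ U) :
    IsCorankTwoCompletable U := by
  refine of_pattern genericallyCompletable_path_add_edge rfl
    (injective_three hab hac hbc) (injective_three hpq hpr hqr) ?_
  rintro x (rfl | rfl | rfl | rfl) <;> simpa

/-- The case that some row contains two unspecified entries. -/
lemma of_row {a c c' : Fin n} (hc : c ≠ c') (h₁ : (a, c) ∈ U) (h₂ : (a, c') ∈ U)
    (hU : ∀ i j, ∃ p ∈ U, p.1 ≠ i ∧ p.2 ≠ j) : IsCorankTwoCompletable U := by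
  by_cases hrow : ∀ b ≠ a, ∀ d d', (b, d) ∈ U → (b, d') ∈ U → d = d'
  swap
  · push Not at hrow
    obtain ⟨b, hb, d, d', h₃, h₄, hd⟩ := hrow
    exact of_two_rows hb.symm hc hd h₁ h₂ h₃ h₄
  by_cases hcol : ∀ j b b', (b, j) ∈ U → (b', j) ∈ U → b = b'
  · obtain ⟨⟨w, x⟩, hw, hwa, -⟩ := hU a c
    obtain ⟨⟨y, z⟩, hy, hya, hzx⟩ := hU a x
    have hwy : w ≠ y := fun h => hzx (hrow y hya z x hy (h ▸ hw))
    have hne : ∀ {i j}, i ≠ a → (i, j) ∈ U → ∀ k, (a, k) ∈ U → k ≠ j := by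
      rintro i j hi hij k hk rfl
      exact hi (hcol _ _ _ hij hk)
    exact of_cherry_add_two_edges (Ne.symm hwa) (Ne.symm hya) hwy (hne hwa hw _ h₁)
      (hne hya hy _ h₁) hc (Ne.symm hzx) (hne hwa hw _ h₂).symm (hne hya hy _ h₂).symm h₁ h₂ hw hy
  push Not at hcol
  obtain ⟨j, b, b', hb, hb', hbb⟩ := hcol
  by_cases hcol' : ∀ j' ≠ j, ∀ d d', (d, j') ∈ U → (d', j') ∈ U → d = d'
  swap
  · push Not at hcol'
    obtain ⟨j', hj, d, d', h₃, h₄, hd⟩ := hcol'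
    exact of_two_columns hj.symm hbb hd hb hb' h₃ h₄
  obtain ⟨d, hd, hda⟩ : ∃ d, (d, j) ∈ U ∧ d ≠ a := by
    by_cases h : b = a
    · exact ⟨b', hb', fun h' => hbb (h.trans h'.symm)⟩
    · exact ⟨b, hb, h⟩
  -- Now only row `a` and column `j` can hold several entries, so `(w, x)` shares no row or column
  -- with any other entry.
  obtain ⟨⟨w, x⟩, hw, hwa, hxj⟩ := hU a j
  have hdw : d ≠ w := fun h => hxj (hrow d hda x j (h ▸ hw) hd)
  have hx : ∀ k, (a, k) ∈ U → k ≠ x := by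
    rintro k hk rfl
    exact hwa (hcol' _ hxj _ _ hw hk)
  by_cases haj : (a, j) ∈ U
  · obtain ⟨e, he, hej⟩ : ∃ e, (a, e) ∈ U ∧ e ≠ j := by
      by_cases h : c = j
      · exact ⟨c', h₂, fun h' => hc (h.trans h'.symm)⟩
      · exact ⟨c, h₁, h⟩
    exact of_path_add_edge hda.symm (Ne.symm hwa) hdw hej (hx _ he) (Ne.symm hxj) he haj hd hw
  · have hne : ∀ k, (a, k) ∈ U → k ≠ j := by
      rintro k hk rfl
      exact haj hk
    exact of_cherry_add_two_edges hda.symm (Ne.symm hwa) hdw (hne _ h₁) (hx _ h₁) hc (Ne.symm hxj)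
      (hne _ h₂).symm (hx _ h₂).symm h₁ h₂ hd hw

end IsCorankTwoCompletable

/-! ### Partial diagonals and the case distinction -/

lemma mem_circulant_one {m : ℕ} {p : Fin m × Fin m} : p ∈ circulant m 1 ↔ p.1 = p.2 := by
  simp [circulant, Nat.mod_eq_of_lt p.1.isLt, Fin.ext_iff, eq_comm]

lemma isCopyOf_circulant_one_iff {m n : ℕ} {U : Finset (Fin n × Fin n)} :
    IsCopyOf U (circulant m 1) ↔
      ∃ f g : Fin m ↪ Fin n, ∀ p, p ∈ U ↔ ∃ i, (f i, g i) = p := by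
  unfold IsCopyOf
  refine exists_congr fun f => exists_congr fun g => ?_
  rw [Finset.ext_iff]
  refine forall_congr' fun p => iff_congr Iff.rfl ?_
  simp only [Finset.mem_map, mem_circulant_one, Prod.exists]
  constructor
  · rintro ⟨i, j, rfl, h⟩
    exact ⟨i, h⟩
  · rintro ⟨i, h⟩
    exact ⟨i, i, rfl, h⟩

/-- A set with at most one entry in each row and column is a copy of a diagonal. -/
lemma exists_diagonal {m n : ℕ} {U : Finset (Fin n × Fin n)}
    (hrow : ∀ a c c', (a, c) ∈ U → (a, c') ∈ U → c = c')
    (hcol : ∀ c a a', (a, c) ∈ U → (a', c) ∈ U → a = a') (hm : U.card = m) :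
    ∃ f g : Fin m ↪ Fin n, ∀ p, p ∈ U ↔ ∃ i, (f i, g i) = p := by
  let e := (U.equivFinOfCardEq hm).symm
  have hf : Function.Injective fun i => (e i).1.1 := fun i j (h : (e i).1.1 = (e j).1.1) => by
    have hj : ((e i).1.1, (e j).1.2) ∈ U := by simp [h]
    exact e.injective (Subtype.ext (Prod.ext h (hrow _ _ _ (e i).2 hj)))
  have hg : Function.Injective fun i => (e i).1.2 := fun i j (h : (e i).1.2 = (e j).1.2) => by
    have hj : ((e j).1.1, (e i).1.2) ∈ U := by simp [h]
    exact e.injective (Subtype.ext (Prod.ext (hcol _ _ _ (e i).2 hj) h))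
  refine ⟨⟨_, hf⟩, ⟨_, hg⟩, fun p => ⟨fun hp => ⟨e.symm ⟨p, hp⟩, by simp⟩, ?_⟩⟩
  rintro ⟨i, rfl⟩
  exact (e i).2

lemma isCorankTwoCompletable_of_not {n : ℕ} {U : Finset (Fin n × Fin n)} (hne : U.Nonempty)
    (h₁ : ¬ InRowUnionColumn U) (h₃ : ¬ IsCopyOf U (circulant 3 1))
    (h₄ : ¬ IsCopyOf U (circulant 4 1)) :
    IsCorankTwoCompletable (U : Set (Fin n × Fin n)) := by
  have hU : ∀ i j, ∃ p ∈ U, p.1 ≠ i ∧ p.2 ≠ j := by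
    simpa [InRowUnionColumn, not_or] using h₁
  by_cases hrow : ∀ a c c', (a, c) ∈ U → (a, c') ∈ U → c = c'
  swap
  · push Not at hrow
    obtain ⟨a, c, c', h, h', hc⟩ := hrow
    exact .of_row hc h h' hU
  by_cases hcol : ∀ c a a', (a, c) ∈ U → (a', c) ∈ U → a = a'
  swap
  · push Not at hcol
    obtain ⟨a, c, c', h, h', hc⟩ := hcol
    refine .of_swap (.of_row hc h h' fun i j => ?_)
    obtain ⟨p, hp, hpj, hpi⟩ := hU j i
    exact ⟨p.swap, by simpa using hp, hpi, hpj⟩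
  rw [isCopyOf_circulant_one_iff] at h₃ h₄
  have hn3 : U.card ≠ 3 := fun h => h₃ (exists_diagonal hrow hcol h)
  have hn4 : U.card ≠ 4 := fun h => h₄ (exists_diagonal hrow hcol h)
  -- A partial diagonal with at most two entries is covered by a row and a column.
  have hcard : 3 ≤ U.card := by
    obtain ⟨p, hp⟩ := hne
    obtain ⟨q, hq, hq₁, -⟩ := hU p.1 p.2
    obtain ⟨r, hr, hr₁, hr₂⟩ := hU p.1 q.2
    refine le_of_eq_of_le (Finset.card_eq_three.2 ⟨p, q, r, ?_, ?_, ?_, rfl⟩).symm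
      (Finset.card_le_card (s := {p, q, r}) ?_)
    · exact fun h => hq₁ (h ▸ rfl)
    · exact fun h => hr₁ (h ▸ rfl)
    · exact fun h => hr₂ (h ▸ rfl)
    · simp [Finset.insert_subset_iff, hp, hq, hr]
  have h5 : 5 ≤ U.card := by omega
  obtain ⟨f, g, hfg⟩ := exists_diagonal hrow hcol rfl
  refine .of_pattern genericallyCompletable_diagonal_five rfl
    (f := f ∘ Fin.castLE h5) (g := g ∘ Fin.castLE h5)
    (f.injective.comp (Fin.castLE_injective h5)) (g.injective.comp (Fin.castLE_injective h5)) ?_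
  rintro ⟨i, j⟩ (rfl : i = j)
  exact (hfg _).2 ⟨_, rfl⟩

/-! ### Partial fillings and typical ranks -/

/-- The matrix with the entries of `A` at the specified positions and those of `y` elsewhere. -/
def extend {n : ℕ} {U : Finset (Fin n × Fin n)} (y : Fin n × Fin n → ℝ) (A : PartialFilling Uᶜ) :
    Fin n × Fin n → ℝ :=
  fun p => if h : p ∈ Uᶜ then A ⟨p, h⟩ else y p

section extend

variable {n : ℕ} {U : Finset (Fin n × Fin n)}

lemma isPoly_extend (y : Fin n × Fin n → ℝ) (p : Fin n × Fin n) :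
    IsPoly fun A : PartialFilling Uᶜ => extend y A p := by
  unfold extend
  split_ifs with h
  · exact IsPoly.coord _
  · exact IsPoly.const _

lemma extend_restrict (y : Fin n × Fin n → ℝ) :
    extend (U := U) y (fun p => y p.1) = y := by
  ext p
  simp [extend]

lemma IsCompletion.apply_eq {A : PartialFilling Uᶜ} {M : Matrix (Fin n) (Fin n) ℝ}
    (hM : IsCompletion A M) (y : Fin n × Fin n → ℝ) {i j : Fin n} (h : (i, j) ∉ U) :
    M i j = extend y A (i, j) := by
  rw [extend, dif_pos (Finset.mem_compl.2 h)]
  exact hM ⟨(i, j), _⟩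

/-- The polynomial may involve entries in `U`. Freezing those at a point where it does not vanish
leaves a nonzero polynomial in the specified entries. -/
lemma GenericallyCompletable.isGenericallyRealCompletable {r : ℕ}
    (h : GenericallyCompletable (U : Set (Fin n × Fin n)) r) :
    IsGenericallyRealCompletable Uᶜ r := by
  obtain ⟨F, hF, ⟨y, hy⟩, h⟩ := h
  obtain ⟨f, hf⟩ := hF.comp (φ := extend (U := U) y) (isPoly_extend y)
  refine ⟨f, ?_, fun A hA => ?_⟩
  · rintro rfl
    apply hy
    have h0 := hf fun p => y p.1
    simp only [extend_restrict, map_zero] at h0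
    exact h0.symm
  · rw [hf] at hA
    obtain ⟨M, hM, hr⟩ := h _ hA
    refine ⟨M, fun p => ?_, hr⟩
    rw [hM p.1 (Finset.mem_compl.1 p.2), extend, dif_pos p.2]

end extend

/-! ### Obstructions to corank two on open sets -/

lemma card_le_rank_of_det_submatrix_ne_zero {k m n : ℕ} (M : Matrix (Fin m) (Fin n) ℝ)
    (f : Fin k → Fin m) (g : Fin k → Fin n) (h : (M.submatrix f g).det ≠ 0) : k ≤ M.rank := by
  have := M.rank_submatrix_le f g
  rwa [Matrix.rank_of_isUnit _ ((Matrix.isUnit_iff_isUnit_det _).2 (isUnit_iff_ne_zero.2 h)),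
    Fintype.card_fin] at this

/-- If no filling in some nonempty open set can be completed to corank two, then one is a
typical corank. -/
lemma isTypicalCorank_one_of_isOpen {n : ℕ} {U : Finset (Fin n × Fin n)} (hU : U.Nonempty)
    {O : Set (PartialFilling Uᶜ)} (hO : IsOpen O) (hne : O.Nonempty)
    (h : ∀ A ∈ O, ∀ M, IsCompletion A M → n ≤ M.rank + 1) : IsTypicalCorank Uᶜ 1 := by
  obtain ⟨q, hq⟩ := hU
  have hn : 1 ≤ n := by have := q.1.isLt; omega
  -- A single free entry is a `1 × 1` pattern completable to rank 0, so corank 1 is generically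
  -- attained.
  obtain ⟨f, hf, hcompl⟩ := ((genericallyCompletable_univ 1).embed
    ⟨fun _ => q.1, Function.injective_of_subsingleton _⟩
    ⟨fun _ => q.2, Function.injective_of_subsingleton _⟩ (U := U)
    fun _ _ => hq).isGenericallyRealCompletable
  refine ⟨n - 1, ⟨O ∩ {A | eval A f ≠ 0}, isZariskiDense_of_isOpen
    (hO.inter (isOpen_ne_fun (MvPolynomial.continuous_eval f) continuous_const)) ?_, ?_⟩, ?_⟩
  · by_contra hempty
    refine hf (isZariskiDense_of_isOpen hO hne f fun A hA => ?_)
    by_contra hA'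
    exact hempty ⟨A, hA, hA'⟩
  · rintro A ⟨hA, hA'⟩
    constructor
    · obtain ⟨M, hM, hr⟩ := hcompl A hA'
      have := h A hA M hM
      exact ⟨M, hM, by omega⟩
    · rintro k ⟨M, hM, rfl⟩
      have := h A hA M hM
      omega
  · rw [min_self]
    omega

/-- Deleting the row and the column leaves a fully specified minor, nonzero on an open set. The
filling taken from `y` makes it the identity. -/
lemma isTypicalCorank_one_of_inRowUnionColumn {n : ℕ} {U : Finset (Fin n × Fin n)}
    (hU : U.Nonempty) (h : InRowUnionColumn U) : IsTypicalCorank Uᶜ 1 := by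
  obtain ⟨i, j, h⟩ := h
  obtain _ | n := n
  · exact i.elim0
  classical
  let y : Fin (n + 1) × Fin (n + 1) → ℝ := fun p =>
    if ∃ a, (i.succAbove a, j.succAbove a) = p then 1 else 0
  let N : PartialFilling Uᶜ → Matrix (Fin n) (Fin n) ℝ := fun A =>
    .of fun a b => extend y A (i.succAbove a, j.succAbove b)
  have hN : IsPoly fun A => (N A).det := IsPoly.det fun a b => isPoly_extend y (i.succAbove a, j.succAbove b)
  refine isTypicalCorank_one_of_isOpen hU (O := {A | (N A).det ≠ 0})
    (isOpen_ne_fun hN.continuous continuous_const) ⟨fun p => y p.1, ?_⟩ fun A hA M hM => ?_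
  · have : N (fun p => y p.1) = 1 := by
      ext a b
      simp only [N, extend_restrict, Matrix.of_apply, Matrix.one_apply, y]
      simp [eq_comm]
    simp [this]
  · have hMN : M.submatrix i.succAbove j.succAbove = N A := by
      ext a b
      refine hM.apply_eq y fun hab => ?_
      rcases h _ hab with h | h
      · exact Fin.succAbove_ne _ _ h
      · exact Fin.succAbove_ne _ _ h
    have := card_le_rank_of_det_submatrix_ne_zero M i.succAbove j.succAbove (by rwa [hMN])
    omega

/-- An open set of `m × m` matrices that cannot be changed on the diagonal so as to have
corank two shows that one is a typical corank for all copies of the diagonal. -/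
lemma isTypicalCorank_one_of_diagonal {m n : ℕ} (hm : 0 < m) {U : Finset (Fin n × Fin n)}
    (hU : IsCopyOf U (circulant m 1)) {O : Set (Fin m × Fin m → ℝ)} (hO : IsOpen O)
    (hne : O.Nonempty) (h : ∀ x ∈ O, ∀ Y : Matrix (Fin m) (Fin m) ℝ,
      (∀ i j, i ≠ j → Y i j = x (i, j)) → m ≤ Y.rank + 1) : IsTypicalCorank Uᶜ 1 := by
  obtain ⟨f, g, hfg⟩ := isCopyOf_circulant_one_iff.1 hU
  obtain ⟨x, hx⟩ := hne
  obtain ⟨e₁, he₁⟩ := exists_equiv_sum f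
  obtain ⟨e₂, he₂⟩ := exists_equiv_sum g
  have hmn : m ≤ n := by simpa using Fintype.card_le_of_injective f f.injective
  let y : Fin n × Fin n → ℝ := fun p =>
    Matrix.fromBlocks (.of fun i j => x (i, j)) 0 0 1 (e₁ p.1) (e₂ p.2)
  let N : PartialFilling Uᶜ → Matrix (Fin m ⊕ Fin (n - m)) (Fin m ⊕ Fin (n - m)) ℝ := fun A =>
    .of fun a b => extend y A (e₁.symm a, e₂.symm b)
  have hN : ∀ a b, IsPoly fun A => N A a b := fun a b => isPoly_extend y (e₁.symm a, e₂.symm b)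
  have hdet : IsPoly fun A => (N A).toBlocks₂₂.det := IsPoly.det fun a b => hN (.inr a) (.inr b)
  let S : PartialFilling Uᶜ → Fin m × Fin m → ℝ := fun A p => schur (N A) p.1 p.2
  have hS : Continuous S := continuous_pi fun p => (isPoly_schur hN p.1 p.2).continuous
  have hopen : IsOpen ({A | (N A).toBlocks₂₂.det ≠ 0} ∩ S ⁻¹' O) :=
    (isOpen_ne_fun hdet.continuous continuous_const).inter (hO.preimage hS)
  refine isTypicalCorank_one_of_isOpen ⟨(f ⟨0, hm⟩, g ⟨0, hm⟩), (hfg _).2 ⟨_, rfl⟩⟩ hopen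
    ⟨fun p => y p.1, ?_⟩ ?_
  · have hy : N (fun p => y p.1) = Matrix.fromBlocks (.of fun i j => x (i, j)) 0 0 1 := by
      ext a b
      simp [N, extend_restrict, y]
    refine ⟨?_, ?_⟩
    · simp [hy]
    · simpa [S, hy, schur_fromBlocks] using hx
  · rintro A ⟨hA, hAO⟩ M hM
    let M' := M.submatrix e₁.symm e₂.symm
    -- Completions vary only on the diagonal of the upper left block, so the Schur complement varies
    -- only on its diagonal.
    have hM' : ∀ a b, (∀ i, ¬ (a = .inl i ∧ b = .inl i)) → M' a b = N A a b := by
      refine fun a b hab => hM.apply_eq y fun hU => ?_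
      obtain ⟨i, hi⟩ := (hfg _).1 hU
      obtain ⟨h1, h2⟩ := Prod.ext_iff.1 hi
      refine hab i ⟨?_, ?_⟩
      · rw [← he₁, show f i = e₁.symm a from h1, Equiv.apply_symm_apply]
      · rw [← he₂, show g i = e₂.symm b from h2, Equiv.apply_symm_apply]
    have h₂₂ : M'.toBlocks₂₂ = (N A).toBlocks₂₂ := by
      ext a b
      exact hM' _ _ (by simp)
    have h₁₂ : M'.toBlocks₁₂ = (N A).toBlocks₁₂ := by
      ext a b
      exact hM' _ _ (by simp)
    have h₂₁ : M'.toBlocks₂₁ = (N A).toBlocks₂₁ := by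
      ext a b
      exact hM' _ _ (by simp)
    have hr := rank_eq_rank_schur_add M' (by rwa [h₂₂])
    rw [Matrix.rank_submatrix] at hr
    have := h _ hAO (schur M') fun i j hij => by
      have h₁₁ : M'.toBlocks₁₁ i j = (N A).toBlocks₁₁ i j :=
        hM' _ _ fun k hk => hij (Sum.inl_injective (hk.1.trans hk.2.symm))
      simp only [S, schur, Matrix.sub_apply, Matrix.smul_apply, h₁₁, h₁₂, h₂₁, h₂₂]
    omega

/-- Rank at most 1 forces the two 3-cycle products of off-diagonal entries to agree: eliminate `Y 1
1` from two `2 × 2` minors. -/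
lemma isTypicalCorank_one_of_diagonal_three {n : ℕ} {U : Finset (Fin n × Fin n)}
    (hU : IsCopyOf U (circulant 3 1)) : IsTypicalCorank Uᶜ 1 := by
  refine isTypicalCorank_one_of_diagonal (by norm_num) hU
    (O := {x | x (0, 1) * x (1, 2) * x (2, 0) - x (0, 2) * x (1, 0) * x (2, 1) ≠ 0})
    (isOpen_ne_fun (by fun_prop) continuous_const)
    ⟨fun p => (!![0, 1, 0; 0, 0, 1; 1, 0, 0] : Matrix _ _ ℝ) p.1 p.2, by simp⟩ fun x hx Y hY => ?_
  by_contra hr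
  have minor : ∀ f g : Fin 2 → Fin 3, (Y.submatrix f g).det = 0 := fun f g => by
    by_contra hfg
    have := card_le_rank_of_det_submatrix_ne_zero Y f g hfg
    omega
  have h₁ := minor ![0, 1] ![1, 2]
  have h₂ := minor ![1, 2] ![0, 1]
  rw [Matrix.det_fin_two] at h₁ h₂
  simp at h₁ h₂
  apply hx
  simp only [← hY, ne_eq, Fin.reduceEq, not_false_eq_true]
  linear_combination Y 2 0 * h₁ - Y 0 2 * h₂

/-- Two `3 × 3` minors are bilinear in the diagonal entries `Y 2 2` and `Y 3 3`. Eliminating their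
product gives a linear relation, and substituting it back gives a quadratic for `Y 2 2`. Where its
discriminant is negative there is no real completion of rank at most 2. -/
lemma isTypicalCorank_one_of_diagonal_four {n : ℕ} {U : Finset (Fin n × Fin n)}
    (hU : IsCopyOf U (circulant 4 1)) : IsTypicalCorank Uᶜ 1 := by
  let α : (Fin 4 × Fin 4 → ℝ) → ℝ := fun x =>
    x (0, 1) * x (1, 2) * x (2, 0) - x (1, 0) * x (0, 2) * x (2, 1)
  let β : (Fin 4 × Fin 4 → ℝ) → ℝ := fun x =>
    x (0, 1) * x (1, 3) * x (3, 0) - x (1, 0) * x (0, 3) * x (3, 1)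
  let c : (Fin 4 × Fin 4 → ℝ) → ℝ := fun x =>
    x (0, 2) * x (2, 3) * x (3, 1) + x (0, 3) * x (3, 2) * x (2, 1) - x (0, 1) * x (2, 3) * x (3, 2)
  let c' : (Fin 4 × Fin 4 → ℝ) → ℝ := fun x =>
    x (1, 2) * x (2, 3) * x (3, 0) + x (1, 3) * x (3, 2) * x (2, 0) - x (1, 0) * x (2, 3) * x (3, 2)
  let γ : (Fin 4 × Fin 4 → ℝ) → ℝ := fun x => x (1, 0) * c x - x (0, 1) * c' x
  let p : (Fin 4 × Fin 4 → ℝ) → ℝ := fun x => -(x (0, 1) * β x)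
  let q : (Fin 4 × Fin 4 → ℝ) → ℝ := fun x =>
    -(x (0, 1) * γ x) + x (0, 2) * x (2, 1) * β x - x (0, 3) * x (3, 1) * α x
  let r : (Fin 4 × Fin 4 → ℝ) → ℝ := fun x => x (0, 2) * x (2, 1) * γ x + c x * α x
  refine isTypicalCorank_one_of_diagonal (by norm_num) hU
    (O := {x | q x ^ 2 - 4 * p x * r x < 0})
    (isOpen_lt (by fun_prop) continuous_const)
    -- Here `p = 1`, `q = -1`, `r = 1`, with discriminant `-3`.
    ⟨fun p => (!![0, -1, 0, 1; 0, 0, 1, 1; 1, 1, 0, 0; -1, 0, -1, 0] : Matrix _ _ ℝ) p.1 p.2,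
      by simp [α, β, c, c', γ, p, q, r]⟩ fun x hx Y hY => ?_
  by_contra hr
  have minor : ∀ f g : Fin 3 → Fin 4, (Y.submatrix f g).det = 0 := fun f g => by
    by_contra hfg
    have := card_le_rank_of_det_submatrix_ne_zero Y f g hfg
    omega
  have h₁ := minor ![0, 2, 3] ![1, 2, 3]
  have h₂ := minor ![1, 2, 3] ![0, 2, 3]
  rw [Matrix.det_fin_three] at h₁ h₂
  simp at h₁ h₂
  simp only [hY, ne_eq, Fin.reduceEq, not_false_eq_true] at h₁ h₂
  have hlin : α x * Y 3 3 + β x * Y 2 2 + γ x = 0 := by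
    simp only [α, β, γ, c, c']
    linear_combination x (1, 0) * h₁ - x (0, 1) * h₂
  have hquad : p x * Y 2 2 ^ 2 + q x * Y 2 2 + r x = 0 := by
    simp only [p, q, r, c]
    linear_combination α x * h₁ - (x (0, 1) * Y 2 2 - x (0, 2) * x (2, 1)) * hlin
  have hsq : q x ^ 2 - 4 * p x * r x = (2 * p x * Y 2 2 + q x) ^ 2 := by
    linear_combination -4 * p x * hquad
  exact absurd (hsq ▸ hx : (2 * p x * Y 2 2 + q x) ^ 2 < 0) (not_lt.2 (sq_nonneg _))

/-! ### Excluding typical corank one -/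

/-- With everything specified, corank 1 on a dense set would make the determinant the zero
polynomial. -/
lemma not_isTypicalCorank_one_of_empty {n : ℕ} :
    ¬ IsTypicalCorank (∅ : Finset (Fin n × Fin n))ᶜ 1 := by
  rintro ⟨r, ⟨D, hD, hr⟩, hrn⟩
  let y : Fin n × Fin n → ℝ := fun p => (1 : Matrix (Fin n) (Fin n) ℝ) p.1 p.2
  obtain ⟨f, hf⟩ := IsPoly.det (M := fun A : PartialFilling (∅ : Finset (Fin n × Fin n))ᶜ =>
    .of fun i j => extend y A (i, j)) fun i j => isPoly_extend y (i, j)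
  have hf0 : f = 0 := hD f fun A hA => by
    obtain ⟨M, hM, hMr⟩ := (hr A hA).1
    rw [hf]
    by_contra hdet
    have hMA : M = .of fun i j => extend y A (i, j) := by
      ext i j
      exact hM.apply_eq y (by simp)
    have := card_le_rank_of_det_submatrix_ne_zero M id id (by rwa [Matrix.submatrix_id_id, hMA])
    omega
  have h1 := hf fun p => y p.1
  have h2 : (Matrix.of fun i j => y (i, j)) = 1 := rfl
  simp only [extend_restrict, hf0, map_zero, h2, Matrix.det_one] at h1
  exact zero_ne_one h1

lemma not_isTypicalCorank_one_of_isGenericallyRealCompletable {n r : ℕ}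
    {S : Finset (Fin n × Fin n)} (hrn : r + 2 = n) (h : IsGenericallyRealCompletable S r) :
    ¬ IsTypicalCorank S 1 := by
  rintro ⟨k, ⟨D, hD, hk⟩, hkn⟩
  obtain ⟨f, hf, h⟩ := h
  refine hf (hD f fun A hA => ?_)
  by_contra hfA
  obtain ⟨M, hM, hMr⟩ := h A hfA
  have := (hk A hA).2 ⟨M, hM, rfl⟩
  omega

end MatrixCompletion

theorem mainTheorem1 (n : ℕ) (U : Finset (Fin n × Fin n)) :
    (MatrixCompletion.IsTypicalCorank Uᶜ 1 ↔
      (U.Nonempty ∧ MatrixCompletion.InRowUnionColumn U) ∨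
        MatrixCompletion.IsCopyOf U (MatrixCompletion.circulant 3 1) ∨
        MatrixCompletion.IsCopyOf U (MatrixCompletion.circulant 4 1)) ∧
    (U.Nonempty →
      ¬ MatrixCompletion.InRowUnionColumn U →
      ¬ MatrixCompletion.IsCopyOf U (MatrixCompletion.circulant 3 1) →
      ¬ MatrixCompletion.IsCopyOf U (MatrixCompletion.circulant 4 1) →
      ∃ r : ℕ, r + 2 = n ∧ MatrixCompletion.IsGenericallyRealCompletable Uᶜ r) := by
  have key : U.Nonempty →
      ¬ MatrixCompletion.InRowUnionColumn U →
      ¬ MatrixCompletion.IsCopyOf U (MatrixCompletion.circulant 3 1) →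
      ¬ MatrixCompletion.IsCopyOf U (MatrixCompletion.circulant 4 1) →
      ∃ r : ℕ, r + 2 = n ∧ MatrixCompletion.IsGenericallyRealCompletable Uᶜ r := by
    intro hne h₁ h₃ h₄
    obtain ⟨r, hr, h⟩ := MatrixCompletion.isCorankTwoCompletable_of_not hne h₁ h₃ h₄
    exact ⟨r, hr, h.isGenericallyRealCompletable⟩
  refine ⟨⟨fun h => ?_, ?_⟩, key⟩
  · by_contra hcon
    push Not at hcon
    obtain ⟨h₁, h₃, h₄⟩ := hcon
    obtain rfl | hne := U.eq_empty_or_nonempty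
    · exact MatrixCompletion.not_isTypicalCorank_one_of_empty h
    · obtain ⟨r, hr, hc⟩ := key hne (h₁ hne) h₃ h₄
      exact MatrixCompletion.not_isTypicalCorank_one_of_isGenericallyRealCompletable hr hc h
  · rintro (⟨hne, h⟩ | h | h)
    · exact MatrixCompletion.isTypicalCorank_one_of_inRowUnionColumn hne h
    · exact MatrixCompletion.isTypicalCorank_one_of_diagonal_three h
    · exact MatrixCompletion.isTypicalCorank_one_of_diagonal_four h
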